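/- All rings are associative and unital. A topological ring $\mathfrak R$ is \emph{two-sided linear} if its open two-sided ideals form a base of neighborhoods of zero; it is \emph{complete and separated} if the natural map $\mathfrak R\to\varprojlim_{U}\mathfrak R/U$ (over the open subgroups $U$) is bijective. For a complete, separated two-sided linear topological ring $\mathfrak R$ and a set $X$, let $\mathfrak R[[X]]$ be the set of infinite formal linear combinations $\sum_{x\in X}r_xx$ whose families of coefficients converge to zero in $\mathfrak R$ (every open subgroup contains all but finitely many $r_x$). With the unit $x\mapsto 1\cdot x$, with push-forward along maps $X\to Y$ given by (infinite) summation of coefficients over the fibers, and with the multiplication $\mathfrak R[[\mathfrak R[[X]]]]\to\mathfrak R[[X]]$ given by opening the parentheses, $X\mapsto\mathfrak R[[X]]$ is a monad on the category of sets. The category $\mathfrak R\text{-Contra}$ of \emph{left $\mathfrak R$-contramodules} is the category of algebras over this monad; restricting the contraaction map $\pi_{\mathfrak P}\colon\mathfrak R[[\mathfrak P]]\to\mathfrak P$ to finite formal linear combinations defines the forgetful functor $\mathfrak R\text{-Contra}\to\mathfrak R\text{-Mod}$ to left $\mathfrak R$-modules. For an open right ideal $\mathfrak I\subset\mathfrak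 R$, let $\mathfrak I\rightthreetimes\mathfrak P\subset\mathfrak P$ be the image under $\pi_{\mathfrak P}$ of the formal linear combinations with all coefficients in $\mathfrak I$. A contramodule $\mathfrak P$ is \emph{separated} if $\bigcap_{\mathfrak I}(\mathfrak I\rightthreetimes\mathfrak P)=0$, where $\mathfrak I$ ranges over the open right ideals; $\mathfrak R\text{-Separ}\subset\mathfrak R\text{-Contra}$ is the full subcategory of separated contramodules. A continuous ring homomorphism $\mathfrak f\colon\mathfrak R\to\mathfrak S$ induces restriction-of-scalars functors $\mathfrak f_\sharp\colon\mathfrak S\text{-Separ}\to\mathfrak R\text{-Separ}$ and $\mathfrak f_*\colon\mathfrak S\text{-Mod}\to\mathfrak R\text{-Mod}$. The map $\mathfrak f$ is \emph{strongly right taut} if those open two-sided ideals $\mathfrak I\subset\mathfrak R$ for which the closure of the right ideal $\mathfrak f(\mathfrak I)\mathfrak S\subset\mathfrak S$ is an open two-sided ideal of $\mathfrak S$ form a base of neighborhoods of zero in $\mathfrak R$. \textbf{Proposition.} Let $\mathfrak R$ and $\mathfrak S$ be complete, separated two-sided linear topological rings with countable bases of neighborhoods of zero, and let $\mathfrak f\colon\mathfrak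 R\to\mathfrak S$ be a strongly right taut continuous ring homomorphism. Assume that the forgetful functor $\mathfrak R\text{-Contra}\to\mathfrak R\text{-Mod}$ is fully faithful. Then the commutative square of forgetful functors $$ \begin{array}{ccc} \mathfrak S\text{-Separ}&\longrightarrow&\mathfrak S\text{-Mod}\\ {\scriptstyle\mathfrak f_\sharp}\downarrow&&\downarrow{\scriptstyle\mathfrak f_*}\\ \mathfrak R\text{-Separ}&\longrightarrow&\mathfrak R\text{-Mod} \end{array} $$ (commuting up to the natural isomorphism given by the identity maps on underlying sets) is a pseudopullback diagram: the comparison functor from $\mathfrak S\text{-Separ}$ to the category of triples $(M,\mathfrak P,\phi)$, with $M\in\mathfrak S\text{-Mod}$, $\mathfrak P\in\mathfrak R\text{-Separ}$ and $\phi$ an isomorphism between the underlying $\mathfrak R$-modules of $M$ and $\mathfrak P$, is an equivalence of categories. Both horizontal functors in the square are fully faithful. Consequently, the forgetful functor $\mathfrak S\text{-Contra}\to\mathfrak S\text{-Mod}$ is fully faithful, too. -/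

import Mathlib

open CategoryTheory Filter Topology

universe u v w


/-! ### Infinite formal linear combinations -/

section FormalSums

/-- `R[[X]]`: the formal linear combinations `∑ aₓ x` of elements of `X` whose coefficient
family `X → R` converges to zero, i.e. all but finitely many coefficients lie in any given
neighbourhood of zero.  It is a left `R`-submodule of `X → R`. -/
def zeroConvergent (R : Type u) [Ring R] [TopologicalSpace R] [IsTopologicalRing R]
    (X : Type v) : Submodule R (X → R) where
  carrier := {a | Tendsto a cofinite (𝓝 0)}
  add_mem' {a b} ha hb := by
    have h := Tendsto.add (f := a) (g := b) ha hb
    rw [add_zero] at h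
    exact h
  zero_mem' := tendsto_const_nhds
  smul_mem' r a ha := by
    have h := Tendsto.const_mul (f := a) r ha
    rw [mul_zero] at h
    exact h

/-- The type `R[[X]]`. -/
abbrev FormalSum (R : Type u) [Ring R] [TopologicalSpace R] [IsTopologicalRing R]
    (X : Type v) : Type (max u v) := zeroConvergent R X

variable {R : Type u} [Ring R] [UniformSpace R] [IsUniformAddGroup R] [IsTopologicalRing R]

theorem nonarchimedean_of_rightLinear [IsLinearTopology Rᵐᵒᵖ R] : NonarchimedeanAddGroup R where
  is_nonarchimedean U hU := by
    obtain ⟨I, hI, hIU⟩ := (IsLinearTopology.hasBasis_open_submodule Rᵐᵒᵖ).mem_iff.1 hU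
    exact ⟨⟨I.toAddSubgroup, hI⟩, hIU⟩

variable {X : Type v} {Y : Type w}

theorem summable_of_zeroConvergent [IsLinearTopology Rᵐᵒᵖ R] [CompleteSpace R] {a : X → R}
    (ha : Tendsto a cofinite (𝓝 0)) : Summable a :=
  haveI : NonarchimedeanAddGroup R := nonarchimedean_of_rightLinear
  NonarchimedeanAddGroup.summable_of_tendsto_cofinite_zero ha

theorem tendsto_mul_right_zero [IsLinearTopology Rᵐᵒᵖ R] {a : X → R}
    (ha : Tendsto a cofinite (𝓝 0)) (b : X → R) :
    Tendsto (fun x => a x * b x) cofinite (𝓝 0) :=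
  IsLinearTopology.tendsto_mul_zero_of_left a b ha

theorem tsum_mem_of_isOpen [IsLinearTopology Rᵐᵒᵖ R] {a : X → R} (I : Submodule Rᵐᵒᵖ R)
    (hI : IsOpen (I : Set R)) (h : ∀ x, a x ∈ I) : ∑' x, a x ∈ I := by
  have hc : IsClosed (I : Set R) := I.toAddSubgroup.isClosed_of_isOpen hI
  by_cases hs : Summable a
  · exact hc.mem_of_tendsto hs.hasSum (Eventually.of_forall fun s => I.sum_mem fun i _ => h i)
  · rw [tsum_eq_zero_of_not_summable hs]
    exact I.zero_mem

/-- A family `(x, y) ↦ aₓ b_{x,y}` with `a` zero-convergent and each `b_x` zero-convergent is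
zero-convergent. -/
theorem tendsto_mul_prod_zero [IsLinearTopology Rᵐᵒᵖ R] {a : X → R}
    (ha : Tendsto a cofinite (𝓝 0)) {b : X → Y → R}
    (hb : ∀ x, Tendsto (b x) cofinite (𝓝 0)) :
    Tendsto (fun p : X × Y => a p.1 * b p.1 p.2) cofinite (𝓝 0) := by
  refine (IsLinearTopology.hasBasis_open_submodule Rᵐᵒᵖ).tendsto_right_iff.2 fun I hI => ?_
  have hI0 : (I : Set R) ∈ 𝓝 (0 : R) := hI.mem_nhds I.zero_mem
  have h1 : {x | a x ∉ I}.Finite := ha.eventually hI0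
  have h2 : ∀ x, {y | a x * b x y ∉ I}.Finite := fun x => by
    have h := Tendsto.const_mul (a x) (hb x)
    rw [mul_zero] at h
    exact h.eventually hI0
  refine ((h1.biUnion fun x _ => (h2 x).image fun y => (x, y))).subset ?_
  rintro ⟨x, y⟩ hxy
  have hxy' : a x * b x y ∉ I := hxy
  simp only [Set.mem_iUnion, Set.mem_image, Set.mem_ofPred_eq]
  exact ⟨x, fun hx => hxy' (I.smul_mem (MulOpposite.op (b x y)) hx), y, hxy', rfl⟩

theorem tendsto_tsum_snd_zero [IsLinearTopology Rᵐᵒᵖ R] {c : X × Y → R}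
    (hc : Tendsto c cofinite (𝓝 0)) :
    Tendsto (fun y => ∑' x, c (x, y)) cofinite (𝓝 0) := by
  refine (IsLinearTopology.hasBasis_open_submodule Rᵐᵒᵖ).tendsto_right_iff.2 fun I hI => ?_
  have h1 : {p | c p ∉ I}.Finite := hc.eventually (hI.mem_nhds I.zero_mem)
  refine (h1.image Prod.snd).subset fun y hy => ?_
  by_contra hcon
  refine hy (tsum_mem_of_isOpen I hI fun x => ?_)
  by_contra hx
  exact hcon ⟨(x, y), hx, rfl⟩

namespace FormalSum

open Classical in
/-- The map `X → R[[X]]` sending `x` to the formal linear combination `1 · x`. -/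
noncomputable def single (x : X) : FormalSum R X :=
  ⟨Pi.single x 1, by
    refine Tendsto.congr' ?_ tendsto_const_nhds
    refine (Set.finite_singleton x).subset fun y hy => ?_
    by_contra hne
    exact hy (Pi.single_eq_of_ne (M := fun _ : X => R) hne 1).symm⟩

variable [IsLinearTopology Rᵐᵒᵖ R]

/-- The map `R[[X]] → R[[Y]]` induced by `f : X → Y`, which sends `∑ aₓ x` to `∑ b_y y` with
`b_y = ∑_{f x = y} aₓ`, the infinite sum being taken in the topology of `R`. -/
noncomputable def map (f : X → Y) (a : FormalSum R X) : FormalSum R Y :=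
  ⟨fun y => ∑' x : f ⁻¹' {y}, a.1 x, by
    refine (IsLinearTopology.hasBasis_open_submodule Rᵐᵒᵖ).tendsto_right_iff.2 fun I hI => ?_
    have h1 : {x | a.1 x ∉ I}.Finite := Tendsto.eventually a.2 (hI.mem_nhds I.zero_mem)
    refine (h1.image f).subset fun y hy => ?_
    by_contra hcon
    refine hy (tsum_mem_of_isOpen I hI fun x => ?_)
    by_contra hx
    exact hcon ⟨x.1, hx, x.2⟩⟩

/-- Opening of parentheses, `R[[R[[X]]]] → R[[X]]`: the coefficient of `x` in `∑ zₐ a` is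
`∑ₐ zₐ aₓ`. -/
noncomputable def join (z : FormalSum R (FormalSum R X)) : FormalSum R X :=
  ⟨fun x => ∑' a : FormalSum R X, z.1 a * a.1 x,
    tendsto_tsum_snd_zero (c := fun p : FormalSum R X × X => z.1 p.1 * p.1.1 p.2)
      (tendsto_mul_prod_zero z.2 fun a => a.2)⟩

/-- Substitution of formal linear combinations `g x` for the elements `x` in `∑ aₓ x`. -/
noncomputable def bind (a : FormalSum R X) (g : X → FormalSum R Y) : FormalSum R Y :=
  ⟨fun y => ∑' x, a.1 x * (g x).1 y,
    tendsto_tsum_snd_zero (c := fun p : X × Y => a.1 p.1 * (g p.1).1 p.2)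
      (tendsto_mul_prod_zero a.2 fun x => (g x).2)⟩

theorem join_eq (z : FormalSum R (FormalSum R X)) : join z = bind z id := rfl

theorem map_eq (f : X → Y) (a : FormalSum R X) :
    map f a = bind a fun x => single (f x) := by
  classical
  ext y
  change ∑' x : f ⁻¹' {y}, a.1 x = ∑' x, a.1 x * (Pi.single (f x) (1 : R) : Y → R) y
  rw [tsum_subtype]
  refine tsum_congr fun x => ?_
  by_cases h : f x = y
  · rw [Set.indicator_of_mem (show x ∈ f ⁻¹' {y} from h), h, Pi.single_eq_same, mul_one]
  · rw [Set.indicator_of_notMem (show x ∉ f ⁻¹' {y} from h), Pi.single_eq_of_ne (Ne.symm h),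
      mul_zero]

variable [T2Space R]

theorem single_bind (x : X) (g : X → FormalSum R Y) : bind (single x) g = g x := by
  classical
  ext y
  change ∑' x', (Pi.single x (1 : R) : X → R) x' * (g x').1 y = (g x).1 y
  rw [tsum_eq_single x fun x' h => by rw [Pi.single_eq_of_ne h, zero_mul], Pi.single_eq_same,
    one_mul]

theorem bind_single (a : FormalSum R X) : bind a single = a := by
  classical
  ext y
  change ∑' x, a.1 x * (Pi.single x (1 : R) : X → R) y = a.1 y
  rw [tsum_eq_single y fun x h => by rw [Pi.single_eq_of_ne (Ne.symm h), mul_zero],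
    Pi.single_eq_same, mul_one]

variable [CompleteSpace R]

theorem bind_bind {Z : Type*} (a : FormalSum R X) (g : X → FormalSum R Y)
    (h : Y → FormalSum R Z) : bind (bind a g) h = bind a fun x => bind (g x) h := by
  ext t
  change ∑' y, (∑' x, a.1 x * (g x).1 y) * (h y).1 t
    = ∑' x, a.1 x * ∑' y, (g x).1 y * (h y).1 t
  have hs : Summable (Function.uncurry fun x y => a.1 x * ((g x).1 y * (h y).1 t)) :=
    summable_of_zeroConvergent (tendsto_mul_prod_zero a.2
      (b := fun x y => (g x).1 y * (h y).1 t) fun x => tendsto_mul_right_zero (g x).2 _)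
  have h1 : ∀ y, Summable fun x => a.1 x * (g x).1 y := fun y =>
    summable_of_zeroConvergent (tendsto_mul_right_zero a.2 _)
  have h2 : ∀ x, Summable fun y => (g x).1 y * (h y).1 t := fun x =>
    summable_of_zeroConvergent (tendsto_mul_right_zero (g x).2 _)
  calc ∑' y, (∑' x, a.1 x * (g x).1 y) * (h y).1 t
      = ∑' y, ∑' x, a.1 x * ((g x).1 y * (h y).1 t) :=
        tsum_congr fun y => by
          rw [← (h1 y).tsum_mul_right]
          exact tsum_congr fun x => mul_assoc _ _ _
    _ = ∑' x, ∑' y, a.1 x * ((g x).1 y * (h y).1 t) := hs.tsum_comm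
    _ = ∑' x, a.1 x * ∑' y, (g x).1 y * (h y).1 t :=
        tsum_congr fun x => (h2 x).tsum_mul_left _

theorem add_bind (a b : FormalSum R X) (g : X → FormalSum R Y) :
    bind (a + b) g = bind a g + bind b g := by
  ext y
  change ∑' x, (a.1 x + b.1 x) * (g x).1 y
    = ∑' x, a.1 x * (g x).1 y + ∑' x, b.1 x * (g x).1 y
  rw [← Summable.tsum_add
    (summable_of_zeroConvergent (tendsto_mul_right_zero a.2 fun x => (g x).1 y))
    (summable_of_zeroConvergent (tendsto_mul_right_zero b.2 fun x => (g x).1 y))]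
  exact tsum_congr fun x => add_mul _ _ _

theorem smul_bind (r : R) (a : FormalSum R X) (g : X → FormalSum R Y) :
    bind (r • a) g = r • bind a g := by
  ext y
  change ∑' x, (r * a.1 x) * (g x).1 y = r * ∑' x, a.1 x * (g x).1 y
  rw [← (summable_of_zeroConvergent
    (tendsto_mul_right_zero a.2 fun x => (g x).1 y)).tsum_mul_left]
  exact tsum_congr fun x => mul_assoc _ _ _

end FormalSum

end FormalSums

/-! ### The monad `R[[-]]` and contramodules -/

section Contramodules

variable (R : Type u) [Ring R] [UniformSpace R] [IsUniformAddGroup R] [IsTopologicalRing R]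
  [IsLinearTopology Rᵐᵒᵖ R] [T2Space R] [CompleteSpace R]

/-- The monad `X ↦ R[[X]]` on the category of sets. -/
noncomputable def formalSumMonad : Monad (Type u) where
  obj X := FormalSum R X
  map f := ↾(FormalSum.map f)
  map_id X := by
    refine ConcreteCategory.hom_ext _ _ fun a => ?_
    change FormalSum.map id a = a
    rw [FormalSum.map_eq]
    exact FormalSum.bind_single a
  map_comp f g := by
    refine ConcreteCategory.hom_ext _ _ fun a => ?_
    change FormalSum.map (fun x => g (f x)) a = FormalSum.map g (FormalSum.map f a)
    simp only [FormalSum.map_eq, FormalSum.bind_bind, FormalSum.single_bind]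
  η := ⟨fun X => ↾(FormalSum.single), fun X Y f => by
    refine ConcreteCategory.hom_ext _ _ fun x => ?_
    change FormalSum.single (f x) = FormalSum.map f (FormalSum.single x)
    simp only [FormalSum.map_eq, FormalSum.single_bind]⟩
  μ := ⟨fun X => ↾(FormalSum.join), fun X Y f => by
    refine ConcreteCategory.hom_ext _ _ fun z => ?_
    change FormalSum.join (FormalSum.map (FormalSum.map f) z)
      = FormalSum.map f (FormalSum.join z)
    simp only [FormalSum.join_eq, FormalSum.map_eq, FormalSum.bind_bind, FormalSum.single_bind,
      id]⟩
  assoc X := by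
    refine ConcreteCategory.hom_ext _ _ fun z => ?_
    change FormalSum.join (FormalSum.map FormalSum.join z)
      = FormalSum.join (FormalSum.join z)
    simp only [FormalSum.join_eq, FormalSum.map_eq, FormalSum.bind_bind, FormalSum.single_bind,
      id]
  left_unit X := by
    refine ConcreteCategory.hom_ext _ _ fun a => ?_
    change FormalSum.join (FormalSum.single a) = a
    rw [FormalSum.join_eq, FormalSum.single_bind, id]
  right_unit X := by
    refine ConcreteCategory.hom_ext _ _ fun a => ?_
    change FormalSum.join (FormalSum.map FormalSum.single a) = a
    simp only [FormalSum.join_eq, FormalSum.map_eq, FormalSum.bind_bind, FormalSum.single_bind,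
      id]
    exact FormalSum.bind_single a

/-- Left `R`-contramodules: the modules (algebras) over the monad `R[[-]]`. -/
abbrev Contra : Type (u + 1) := (formalSumMonad R).Algebra

variable {R}

namespace Contra

/-- The contraaction map `R[[P]] → P`. -/
def act (P : Contra R) (a : FormalSum R P.A) : P.A := P.a a

theorem act_single (P : Contra R) (p : P.A) : P.act (FormalSum.single p) = p :=
  ConcreteCategory.congr_hom P.unit p

theorem act_join (P : Contra R) (z : FormalSum R (FormalSum R P.A)) :
    P.act (FormalSum.join z) = P.act (FormalSum.map P.act z) :=
  ConcreteCategory.congr_hom P.assoc z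

theorem hom_act {P Q : Contra R} (g : P ⟶ Q) (a : FormalSum R P.A) :
    g.f (P.act a) = Q.act (FormalSum.map g.f a) :=
  (ConcreteCategory.congr_hom g.h a).symm

theorem act_surjective (P : Contra R) : Function.Surjective P.act :=
  fun p => ⟨_, P.act_single p⟩

noncomputable instance (P : Contra R) : Zero P.A := ⟨P.act 0⟩

noncomputable instance (P : Contra R) : Add P.A :=
  ⟨fun p q => P.act (FormalSum.single p + FormalSum.single q)⟩

noncomputable instance (P : Contra R) : SMul R P.A :=
  ⟨fun r p => P.act (r • FormalSum.single p)⟩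

noncomputable instance (P : Contra R) : Neg P.A :=
  ⟨fun p => (-1 : R) • p⟩

theorem zero_def (P : Contra R) : (0 : P.A) = P.act 0 := rfl

theorem add_def (P : Contra R) (p q : P.A) :
    p + q = P.act (FormalSum.single p + FormalSum.single q) := rfl

theorem smul_def (P : Contra R) (r : R) (p : P.A) : r • p = P.act (r • FormalSum.single p) := rfl

theorem act_add (P : Contra R) (a b : FormalSum R P.A) : P.act (a + b) = P.act a + P.act b := by
  have h := P.act_join (FormalSum.single a + FormalSum.single b)
  simp only [FormalSum.join_eq, FormalSum.map_eq, FormalSum.add_bind, FormalSum.single_bind,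
    id] at h
  exact h

theorem act_smul (P : Contra R) (r : R) (a : FormalSum R P.A) : P.act (r • a) = r • P.act a := by
  have h := P.act_join (r • FormalSum.single a)
  simp only [FormalSum.join_eq, FormalSum.map_eq, FormalSum.smul_bind, FormalSum.single_bind,
    id] at h
  exact h

theorem act_neg (P : Contra R) (a : FormalSum R P.A) : P.act (-a) = -P.act a := by
  rw [← neg_one_smul R a, act_smul]
  rfl

/-- The additive group structure on a contramodule: `p + q` is the contraaction applied to the
finite formal linear combination `1 · p + 1 · q`. -/
noncomputable instance (P : Contra R) : AddCommGroup P.A where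
  add_assoc p q r := by
    obtain ⟨a, rfl⟩ := P.act_surjective p
    obtain ⟨b, rfl⟩ := P.act_surjective q
    obtain ⟨c, rfl⟩ := P.act_surjective r
    simp only [← act_add, add_assoc]
  zero_add p := by
    obtain ⟨a, rfl⟩ := P.act_surjective p
    rw [zero_def, ← act_add, zero_add]
  add_zero p := by
    obtain ⟨a, rfl⟩ := P.act_surjective p
    rw [zero_def, ← act_add, add_zero]
  add_comm p q := by
    obtain ⟨a, rfl⟩ := P.act_surjective p
    obtain ⟨b, rfl⟩ := P.act_surjective q
    rw [← act_add, ← act_add, add_comm]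
  neg_add_cancel p := by
    obtain ⟨a, rfl⟩ := P.act_surjective p
    rw [← act_neg, ← act_add, neg_add_cancel, zero_def]
  nsmul := nsmulRec
  zsmul := zsmulRec

/-- The underlying left `R`-module of a contramodule: `r • p` is the contraaction applied to
the finite formal linear combination `r · p`. -/
noncomputable instance (P : Contra R) : Module R P.A where
  one_smul p := by
    obtain ⟨a, rfl⟩ := P.act_surjective p
    rw [← act_smul, one_smul]
  mul_smul r s p := by
    obtain ⟨a, rfl⟩ := P.act_surjective p
    simp only [← act_smul, mul_smul]
  smul_zero r := by rw [zero_def, ← act_smul, smul_zero]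
  smul_add r p q := by
    obtain ⟨a, rfl⟩ := P.act_surjective p
    obtain ⟨b, rfl⟩ := P.act_surjective q
    simp only [← act_smul, ← act_add, smul_add]
  add_smul r s p := by
    obtain ⟨a, rfl⟩ := P.act_surjective p
    simp only [← act_smul, ← act_add, add_smul]
  zero_smul p := by
    obtain ⟨a, rfl⟩ := P.act_surjective p
    rw [← act_smul, zero_smul, zero_def]

theorem hom_add {P Q : Contra R} (g : P ⟶ Q) (p q : P.A) : g.f (p + q) = g.f p + g.f q := by
  simp only [add_def, hom_act, FormalSum.map_eq, FormalSum.add_bind, FormalSum.single_bind]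

theorem hom_smul {P Q : Contra R} (g : P ⟶ Q) (r : R) (p : P.A) :
    g.f (r • p) = r • g.f p := by
  simp only [smul_def, hom_act, FormalSum.map_eq, FormalSum.smul_bind, FormalSum.single_bind]

variable (R) in
/-- The forgetful functor from left `R`-contramodules to left `R`-modules. -/
noncomputable def forgetToModule : Contra R ⥤ ModuleCat.{u} R where
  obj P := ModuleCat.of R P.A
  map g := ModuleCat.ofHom
    { toFun := g.f
      map_add' := hom_add g
      map_smul' := hom_smul g }
  map_id _ := rfl
  map_comp _ _ := rfl

/-- For an additive subgroup `A` of `R` (closed, in the intended use), the subgroup `A ⋌ P` of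
`P`: the image under the contraaction map of the formal linear combinations with all
coefficients in `A`. -/
noncomputable def contraSMul (A : AddSubgroup R) (P : Contra R) : AddSubgroup P.A where
  carrier := P.act '' {a | ∀ p, a.1 p ∈ A}
  add_mem' := by
    rintro _ _ ⟨a, ha, rfl⟩ ⟨b, hb, rfl⟩
    exact ⟨a + b, fun p => A.add_mem (ha p) (hb p), P.act_add a b⟩
  zero_mem' := ⟨0, fun _ => A.zero_mem, rfl⟩
  neg_mem' := by
    rintro _ ⟨a, ha, rfl⟩
    exact ⟨-a, fun p => A.neg_mem (ha p), P.act_neg a⟩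

variable (R) in
/-- A contramodule `P` is separated if the intersection of the subgroups `I ⋌ P` over all open
right ideals `I` of `R`, that is, the kernel of `P → lim P / (I ⋌ P)`, is zero. -/
def isSeparated : ObjectProperty (Contra R) := fun P =>
  ∀ p : P.A, (∀ I : Submodule Rᵐᵒᵖ R, IsOpen (I : Set R) → p ∈ contraSMul I.toAddSubgroup P) →
    p = 0

end Contra

variable (R) in
/-- The full subcategory of separated left `R`-contramodules. -/
abbrev Separ : Type (u + 1) := (Contra.isSeparated R).FullSubcategory

variable (R) in
/-- The forgetful functor from separated left `R`-contramodules to left `R`-modules. -/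
noncomputable abbrev Separ.forgetToModule : Separ R ⥤ ModuleCat.{u} R :=
  (Contra.isSeparated R).ι ⋙ Contra.forgetToModule R

end Contramodules

/-! ### Restriction of scalars -/

section Restriction

variable {R S : Type u}
  [Ring R] [UniformSpace R] [IsUniformAddGroup R] [IsTopologicalRing R]
  [IsLinearTopology Rᵐᵒᵖ R] [T2Space R] [CompleteSpace R]
  [Ring S] [UniformSpace S] [IsUniformAddGroup S] [IsTopologicalRing S]
  [IsLinearTopology Sᵐᵒᵖ S] [T2Space S] [CompleteSpace S]
  (f : R →+* S) (hf : Continuous f)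

namespace FormalSum

/-- The map `R[[X]] → S[[X]]` applying `f` to all coefficients. -/
def mapCoeff {X : Type v} (a : FormalSum R X) : FormalSum S X :=
  ⟨fun x => f (a.1 x), by
    have h := (hf.tendsto 0).comp a.2
    rw [map_zero] at h
    exact h⟩

theorem mapCoeff_single {X : Type v} (x : X) :
    mapCoeff f hf (single x) = single x := by
  classical
  ext y
  change f ((Pi.single x (1 : R) : X → R) y) = (Pi.single x (1 : S) : X → S) y
  by_cases h : y = x
  · subst h
    rw [Pi.single_eq_same, Pi.single_eq_same, map_one]
  · rw [Pi.single_eq_of_ne h, Pi.single_eq_of_ne h, map_zero]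

theorem mapCoeff_bind {X : Type v} {Y : Type w} (a : FormalSum R X) (g : X → FormalSum R Y) :
    mapCoeff f hf (bind a g) = bind (mapCoeff f hf a) fun x => mapCoeff f hf (g x) := by
  ext y
  change f (∑' x, a.1 x * (g x).1 y) = ∑' x, f (a.1 x) * f ((g x).1 y)
  rw [(summable_of_zeroConvergent (tendsto_mul_right_zero a.2 _)).map_tsum f hf]
  exact tsum_congr fun x => map_mul f _ _

theorem mapCoeff_map {X : Type v} {Y : Type w} (g : X → Y) (a : FormalSum R X) :
    mapCoeff f hf (map g a) = map g (mapCoeff f hf a) := by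
  simp only [map_eq, mapCoeff_bind, mapCoeff_single]

theorem mapCoeff_join {X : Type v} (z : FormalSum R (FormalSum R X)) :
    mapCoeff f hf (join z) = join (mapCoeff f hf (map (mapCoeff f hf) z)) := by
  simp only [join_eq, map_eq, mapCoeff_bind, mapCoeff_single, bind_bind, single_bind, id]

theorem mapCoeff_add {X : Type v} (a b : FormalSum R X) :
    mapCoeff f hf (a + b) = mapCoeff f hf a + mapCoeff f hf b := by
  ext x
  exact map_add f _ _

theorem mapCoeff_smul {X : Type v} (r : R) (a : FormalSum R X) :
    mapCoeff f hf (r • a) = f r • mapCoeff f hf a := by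
  ext x
  exact map_mul f _ _

theorem mapCoeff_zero {X : Type v} : mapCoeff f hf (0 : FormalSum R X) = 0 := by
  ext x
  exact map_zero f

end FormalSum

/-- The morphism of monads `R[[-]] → S[[-]]` induced by a continuous ring homomorphism. -/
noncomputable def formalSumMonadHom : formalSumMonad R ⟶ formalSumMonad S where
  app X := ↾(FormalSum.mapCoeff f hf)
  naturality X Y g := ConcreteCategory.hom_ext _ _ fun a => FormalSum.mapCoeff_map f hf g a
  app_η X := ConcreteCategory.hom_ext _ _ fun x => FormalSum.mapCoeff_single f hf x
  app_μ X := by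
    refine ConcreteCategory.hom_ext _ _ fun z => ?_
    exact FormalSum.mapCoeff_join f hf z

/-- Restriction of scalars for contramodules along a continuous ring homomorphism. -/
noncomputable def Contra.restrictScalars : Contra S ⥤ Contra R :=
  Monad.algebraFunctorOfMonadHom (formalSumMonadHom f hf)

/-- The contraaction map of the underlying `R`-contramodule of an `S`-contramodule. -/
theorem Contra.restrictScalars_act (P : Contra S) (a : FormalSum R P.A) :
    ((Contra.restrictScalars f hf).obj P).act a = P.act (FormalSum.mapCoeff f hf a) := rfl

theorem Contra.restrictScalars_zero (P : Contra S) :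
    (0 : ((Contra.restrictScalars f hf).obj P).A) = (0 : P.A) := by
  rw [Contra.zero_def, Contra.zero_def]
  exact congrArg P.act (FormalSum.mapCoeff_zero f hf)

theorem Contra.restrictScalars_add (P : Contra S) (p q : P.A) :
    ((Contra.restrictScalars f hf).obj P).act
      ((FormalSum.single p + FormalSum.single q : FormalSum R P.A)) = p + q := by
  change P.act (FormalSum.mapCoeff f hf (FormalSum.single p + FormalSum.single q)) = _
  rw [FormalSum.mapCoeff_add, FormalSum.mapCoeff_single, FormalSum.mapCoeff_single]
  rfl

theorem Contra.restrictScalars_smul (P : Contra S) (r : R) (p : P.A) :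
    ((Contra.restrictScalars f hf).obj P).act
      (r • FormalSum.single p : FormalSum R P.A) = f r • p := by
  change P.act (FormalSum.mapCoeff f hf (r • FormalSum.single p)) = _
  rw [FormalSum.mapCoeff_smul, FormalSum.mapCoeff_single]
  rfl

theorem Contra.isSeparated_restrictScalars (P : Contra S) (hP : Contra.isSeparated S P) :
    Contra.isSeparated R ((Contra.restrictScalars f hf).obj P) := by
  intro p hp
  rw [Contra.restrictScalars_zero]
  refine hP p fun J hJ => ?_
  let I : Submodule Rᵐᵒᵖ R :=
    { carrier := f ⁻¹' J
      add_mem' := fun {a b} ha hb => by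
        change f (a + b) ∈ J
        rw [map_add]
        exact J.add_mem ha hb
      zero_mem' := by
        change f 0 ∈ J
        rw [map_zero]
        exact J.zero_mem
      smul_mem' := fun r a ha => by
        change f (a * r.unop) ∈ J
        rw [map_mul]
        exact J.smul_mem (MulOpposite.op (f r.unop)) ha }
  obtain ⟨a, ha, hap⟩ := hp I (hJ.preimage hf)
  exact ⟨FormalSum.mapCoeff f hf a, fun q => ha q, hap⟩

/-- Restriction of scalars for separated contramodules. -/
noncomputable def Separ.restrictScalars : Separ S ⥤ Separ R :=
  (Contra.isSeparated R).lift ((Contra.isSeparated S).ι ⋙ Contra.restrictScalars f hf)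
    fun P => Contra.isSeparated_restrictScalars f hf P.obj P.property

/-- A bijection that respects the operations, as an isomorphism of modules. -/
def moduleIsoOfEquiv (M N : ModuleCat.{u} R) (e : M ≃ N) (hadd : ∀ x y, e (x + y) = e x + e y)
    (hsmul : ∀ (r : R) x, e (r • x) = r • e x) : M ≅ N :=
  LinearEquiv.toModuleIso { e with map_add' := hadd, map_smul' := hsmul }

/-- The commutative square formed by the forgetful functors `Separ S ⥤ ModuleCat S` and
`Separ R ⥤ ModuleCat R` and the restrictions of scalars, commuting up to the natural isomorphism
which is the identity map on underlying sets. -/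
noncomputable def Separ.squareIso :
    Separ.forgetToModule S ⋙ ModuleCat.restrictScalars.{u} f ≅
      Separ.restrictScalars f hf ⋙ Separ.forgetToModule R :=
  NatIso.ofComponents (fun P => moduleIsoOfEquiv
      ((ModuleCat.restrictScalars.{u} f).obj ((Separ.forgetToModule S).obj P))
      ((Separ.forgetToModule R).obj ((Separ.restrictScalars f hf).obj P))
      (Equiv.refl P.obj.A)
      (fun p q => (Contra.restrictScalars_add f hf P.obj p q).symm)
      (fun r p => (Contra.restrictScalars_smul f hf P.obj r p).symm))
    fun _ => rfl

/-- A ring map `f : R → S` is strongly right taut if the open two-sided ideals `I` of `R` for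
which the closure of the right ideal `f(I) S` is an open two-sided ideal of `S` form a base of
neighbourhoods of zero in `R`. -/
def IsStronglyRightTaut : Prop :=
  (𝓝 (0 : R)).HasBasis
    (fun I : TwoSidedIdeal R => IsOpen (I : Set R) ∧
      ∃ J : TwoSidedIdeal S, IsOpen (J : Set S) ∧
        (J : Set S) = closure (Submodule.span Sᵐᵒᵖ (f '' (I : Set R)) : Set S))
    (fun I => (I : Set R))

end Restriction

/-! ### Pseudopullback squares -/

section Pseudopullback

open Limits CategoricalPullback

/-- A square of functors commuting up to a given natural isomorphism is a pseudopullback diagram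
if the comparison functor to the category of triples `(a, b, F a ≅ G b)` is an equivalence. -/
def IsPseudopullback {A B C D : Type*} [Category A] [Category B] [Category C] [Category D]
    {T : D ⥤ A} {L : D ⥤ B} {F : A ⥤ C} {G : B ⥤ C} (e : T ⋙ F ≅ L ⋙ G) : Prop :=
  ((CatCommSqOver.toFunctorToCategoricalPullback F G D).obj ⟨T, L, e⟩).IsEquivalence

end Pseudopullback

/-!
Write `c(I)` for the closure of `f(I) S`.  By successive approximation along a countable base of
open ideals `I` with `c(I)` open, every formal linear combination with coefficients in `c(I)` has
the form `∑ f(r) s x` with coefficients `r` in `I`.  Since `R`-linear maps between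
`R`-contramodules commute with the contraactions by hypothesis, so do, by this lifting, `S`-linear
maps between `S`-contramodules.

Let now `M` be an `S`-module whose underlying `R`-module is that of a separated `R`-contramodule
`P`.  By the same lifting, `c(I) M` lies in `I ⋌ P`, so that the quotients `M / c(I) M` are jointly
injective.  Each of them is killed by an open ideal, so it is a contramodule by finite summation,
and `P → M / c(I) M` commutes with the contraactions over `R`.  The contraaction over `S` on `M`,
defined by lifting to `R`, therefore becomes finite summation in these quotients, which makes it
well defined, unital and associative.
-/

section FormalSums

namespace FormalSum

section Coefficients

variable {R : Type u} [Ring R] [UniformSpace R] [IsTopologicalRing R] {X : Type v} {Y : Type w}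

/-- `A[[X]]`: the formal linear combinations all of whose coefficients lie in the subgroup `A`. -/
def coeffsIn (A : AddSubgroup R) (X : Type v) : AddSubgroup (FormalSum R X) where
  carrier := {a | ∀ x, a.1 x ∈ A}
  add_mem' ha hb x := A.add_mem (ha x) (hb x)
  zero_mem' _ := A.zero_mem
  neg_mem' ha x := A.neg_mem (ha x)

theorem coeffsIn_mono {A B : AddSubgroup R} (h : A ≤ B) : coeffsIn A X ≤ coeffsIn B X :=
  fun _ ha x => h (ha x)

open Classical in
theorem coe_smul_single (r : R) (x : X) : (r • (single x : FormalSum R X)).1 = Pi.single x r := by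
  change r • (Pi.single x (1 : R) : X → R) = _
  rw [← Pi.single_smul, smul_eq_mul, mul_one]

theorem smul_single_apply_self (r : R) (x : X) : (r • (single x : FormalSum R X)).1 x = r := by
  classical rw [coe_smul_single, Pi.single_eq_same]

theorem smul_single_mem_coeffsIn {A : AddSubgroup R} {r : R} (hr : r ∈ A) (x : X) :
    r • single x ∈ coeffsIn A X := by
  classical
  intro y
  rw [coe_smul_single]
  obtain rfl | hy := eq_or_ne y x
  · rwa [Pi.single_eq_same]
  · rw [Pi.single_eq_of_ne hy]
    exact A.zero_mem

theorem coeffsIn_le {A B : AddSubgroup R} (hA : IsOpen (A : Set R))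
    {V : AddSubgroup (FormalSum R X)} (hAV : coeffsIn A X ≤ V)
    (hBV : ∀ r ∈ B, ∀ x, r • single x ∈ V) : coeffsIn B X ≤ V := by
  classical
  intro a ha
  have hfin : {x | a.1 x ∉ A}.Finite := Tendsto.eventually a.2 (hA.mem_nhds A.zero_mem)
  let b : FormalSum R X := ∑ x ∈ hfin.toFinset, a.1 x • single x
  have hb : b ∈ V := V.sum_mem fun x _ => hBV _ (ha x) x
  have hab : a - b ∈ coeffsIn A X := by
    intro x
    have hbx : b.1 x = if x ∈ hfin.toFinset then a.1 x else 0 := by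
      simp only [b, Submodule.coe_sum, coe_smul_single, Finset.sum_apply, Finset.sum_pi_single]
    change a.1 x - b.1 x ∈ A
    rw [hbx]
    split_ifs with hx
    · rw [sub_self]
      exact A.zero_mem
    · rw [sub_zero]
      exact not_not.1 fun hxA => hx (hfin.mem_toFinset.2 hxA)
  simpa only [sub_add_cancel] using V.add_mem (hAV hab) hb

theorem addMonoidHom_ext {G : Type*} [AddGroup G] {A : AddSubgroup R} (hA : IsOpen (A : Set R))
    {φ ψ : FormalSum R X →+ G} (hφ : ∀ a ∈ coeffsIn A X, φ a = 0)
    (hψ : ∀ a ∈ coeffsIn A X, ψ a = 0)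
    (h : ∀ (r : R) x, φ (r • single x) = ψ (r • single x)) : φ = ψ := by
  have hle : coeffsIn ⊤ X ≤ φ.eqLocus ψ :=
    coeffsIn_le hA (fun a ha => (hφ a ha).trans (hψ a ha).symm) fun r _ x => h r x
  exact AddMonoidHom.ext fun a => hle fun _ => AddSubgroup.mem_top _

theorem eq_zero_of_forall_mem_coeffsIn [IsLinearTopology Rᵐᵒᵖ R] [T2Space R] {a : FormalSum R X}
    (ha : ∀ K : Submodule Rᵐᵒᵖ R, IsOpen (K : Set R) → a ∈ coeffsIn K.toAddSubgroup X) :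
    a = 0 := by
  refine Subtype.ext (funext fun x => ?_)
  have hx : a.1 x ∈ (𝓝 (0 : R)).ker := by
    rw [(IsLinearTopology.hasBasis_open_submodule Rᵐᵒᵖ).ker]
    exact Set.mem_iInter₂.2 fun K hK => ha K hK x
  rwa [ker_nhds] at hx

variable [IsUniformAddGroup R] [IsLinearTopology Rᵐᵒᵖ R]

theorem bind_mem_coeffsIn {I : Submodule Rᵐᵒᵖ R} (hI : IsOpen (I : Set R)) {a : FormalSum R X}
    (ha : a ∈ coeffsIn I.toAddSubgroup X) (g : X → FormalSum R Y) :
    a.bind g ∈ coeffsIn I.toAddSubgroup Y :=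
  fun y => tsum_mem_of_isOpen I hI fun x => I.smul_mem (MulOpposite.op ((g x).1 y)) (ha x)

theorem map_mem_coeffsIn {I : Submodule Rᵐᵒᵖ R} (hI : IsOpen (I : Set R)) {a : FormalSum R X}
    (ha : a ∈ coeffsIn I.toAddSubgroup X) (g : X → Y) : a.map g ∈ coeffsIn I.toAddSubgroup Y := by
  rw [map_eq]
  exact bind_mem_coeffsIn hI ha _

variable [CompleteSpace R] [T2Space R]

theorem exists_forall_sub_sum_range_mem_coeffsIn {A : ℕ → Submodule Rᵐᵒᵖ R}
    (hA : (𝓝 (0 : R)).HasAntitoneBasis fun n => (A n : Set R)) {z : ℕ → FormalSum R X}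
    (hz : ∀ n, z n ∈ coeffsIn (A n).toAddSubgroup X) :
    ∃ s : FormalSum R X,
      ∀ N, s - ∑ n ∈ Finset.range N, z n ∈ coeffsIn (A N).toAddSubgroup X := by
  have hopen : ∀ n, IsOpen (A n : Set R) := fun n =>
    (A n).toAddSubgroup.isOpen_of_mem_nhds (hA.mem n)
  have hsum : ∀ x, Summable fun n => (z n).1 x := fun x =>
    summable_of_zeroConvergent <| Nat.cofinite_eq_atTop ▸ hA.tendsto_right_iff.2 fun N _ =>
      (eventually_ge_atTop N).mono fun n hn => hA.antitone hn (hz n x)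
  have htail : ∀ N x, ∑' n, (z n).1 x - (∑ n ∈ Finset.range N, z n : FormalSum R X).1 x ∈ A N := by
    intro N x
    rw [Submodule.coe_sum, Finset.sum_apply, ← (hsum x).sum_add_tsum_nat_add N, add_sub_cancel_left]
    exact tsum_mem_of_isOpen _ (hopen N) fun n => hA.antitone (Nat.le_add_left N n) (hz (n + N) x)
  refine ⟨⟨fun x => ∑' n, (z n).1 x, hA.tendsto_right_iff.2 fun N _ => ?_⟩, htail⟩
  filter_upwards [Tendsto.eventually (∑ n ∈ Finset.range N, z n : FormalSum R X).2 (hA.mem N)]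
    with x hx
  exact (sub_add_cancel (∑' n, (z n).1 x) _) ▸ (A N).add_mem (htail N x) hx

end Coefficients

section Substitution

variable {R : Type u} [Ring R] [UniformSpace R] [IsUniformAddGroup R] [IsTopologicalRing R]
  [IsLinearTopology Rᵐᵒᵖ R] [T2Space R] {X : Type v} {Y : Type w} {Z : Type*}

theorem map_single (g : X → Y) (x : X) : (single x : FormalSum R X).map g = single (g x) := by
  simp only [map_eq, single_bind]

variable [CompleteSpace R]

theorem map_map (g : X → Y) (h : Y → Z) (a : FormalSum R X) :
    (a.map g).map h = a.map fun x => h (g x) := by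
  simp only [map_eq, bind_bind, single_bind]

theorem map_bind (a : FormalSum R X) (g : X → FormalSum R Y) (h : Y → Z) :
    (a.bind g).map h = a.bind fun x => (g x).map h := by
  simp only [map_eq, bind_bind]

theorem bind_map (g : X → Y) (a : FormalSum R X) (h : Y → FormalSum R Z) :
    (a.map g).bind h = a.bind fun x => h (g x) := by
  simp only [map_eq, bind_bind, single_bind]

theorem map_smul (g : X → Y) (r : R) (a : FormalSum R X) : (r • a).map g = r • a.map g := by
  simp only [map_eq, smul_bind]

end Substitution

end FormalSum

section DiscreteModules

variable (R : Type u) [Ring R]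

/-- The annihilator of a left `R`-module, regarded as a right ideal: the form in which open ideals
enter the subgroups `I ⋌ P`.  A module whose annihilator is open is discrete in the strong sense
that a single open ideal kills it. -/
def rightAnnihilator (N : Type*) [AddCommGroup N] [Module R N] : Submodule Rᵐᵒᵖ R where
  carrier := {r | ∀ n : N, r • n = 0}
  add_mem' hr hs n := by rw [add_smul, hr n, hs n, add_zero]
  zero_mem' n := zero_smul R n
  smul_mem' s r hr n := (mul_smul r s.unop n).trans (hr _)

end DiscreteModules

namespace FormalSum

variable {R : Type u} [Ring R] [UniformSpace R] [IsTopologicalRing R] {X : Type v} {Y : Type w}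
  {N : Type*} [AddCommGroup N] [Module R N] (hN : IsOpen (rightAnnihilator R N : Set R))

include hN in
theorem hasFiniteSupport_smul (a : FormalSum R X) (g : X → N) :
    (fun x => a.1 x • g x).HasFiniteSupport :=
  (Tendsto.eventually a.2 (hN.mem_nhds (rightAnnihilator R N).zero_mem)).subset
    fun x hx hxN => hx (hxN (g x))

/-- The sum `∑ aₓ g(x)` in a module with open annihilator, where all but finitely many of the
terms vanish. -/
noncomputable def linearCombination (g : X → N) : FormalSum R X →ₗ[R] N where
  toFun a := ∑ᶠ x, a.1 x • g x
  map_add' a b := by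
    rw [← finsum_add_distrib (hasFiniteSupport_smul hN a g) (hasFiniteSupport_smul hN b g)]
    exact finsum_congr fun x => add_smul _ _ _
  map_smul' r a := by
    rw [RingHom.id_apply, smul_finsum' _ (hasFiniteSupport_smul hN a g)]
    exact finsum_congr fun x => mul_smul _ _ _

theorem linearCombination_smul_single (g : X → N) (r : R) (x : X) :
    linearCombination hN g (r • single x) = r • g x := by
  classical
  change ∑ᶠ y, (r • (single x : FormalSum R X)).1 y • g y = _
  rw [coe_smul_single, finsum_eq_single _ x fun y hy => by rw [Pi.single_eq_of_ne hy, zero_smul],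
    Pi.single_eq_same]

theorem linearCombination_single (g : X → N) (x : X) :
    linearCombination hN g (single x) = g x := by
  simpa only [one_smul] using linearCombination_smul_single hN g 1 x

theorem linearCombination_eq_zero (g : X → N) {a : FormalSum R X}
    (ha : a ∈ coeffsIn (rightAnnihilator R N).toAddSubgroup X) : linearCombination hN g a = 0 :=
  (finsum_congr fun x => ha x (g x)).trans finsum_zero

variable [IsUniformAddGroup R] [IsLinearTopology Rᵐᵒᵖ R] [T2Space R] [CompleteSpace R]

theorem linearCombination_bind (h : X → FormalSum R Y) (g : Y → N) (a : FormalSum R X) :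
    linearCombination hN g (a.bind h) =
      linearCombination hN (fun x => linearCombination hN g (h x)) a := by
  let bindHom : FormalSum R X →+ FormalSum R Y := AddMonoidHom.mk' (bind · h) (add_bind · · h)
  refine DFunLike.congr_fun (addMonoidHom_ext hN
    (φ := (linearCombination hN g).toAddMonoidHom.comp bindHom)
    (ψ := (linearCombination hN fun x => linearCombination hN g (h x)).toAddMonoidHom)
    (fun b hb => linearCombination_eq_zero hN g (bind_mem_coeffsIn hN hb h))
    (fun b hb => linearCombination_eq_zero hN _ hb) fun r x => ?_) a
  change linearCombination hN g ((r • single x).bind h) = linearCombination hN _ (r • single x)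
  rw [linearCombination_smul_single, smul_bind, single_bind, LinearMap.map_smul]

theorem linearCombination_map (h : X → Y) (g : Y → N) (a : FormalSum R X) :
    linearCombination hN g (a.map h) = linearCombination hN (fun x => g (h x)) a := by
  rw [map_eq, linearCombination_bind]
  simp only [linearCombination_single]

end FormalSum

end FormalSums

section Contramodules

variable {R : Type u} [Ring R] [UniformSpace R] [IsUniformAddGroup R] [IsTopologicalRing R]
  [IsLinearTopology Rᵐᵒᵖ R] [T2Space R] [CompleteSpace R]

namespace Contra

theorem act_bind (P : Contra R) {X : Type v} (a : FormalSum R X) (g : X → FormalSum R P.A) :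
    P.act (a.bind g) = P.act (a.map fun x => P.act (g x)) := by
  simpa only [FormalSum.join_eq, FormalSum.bind_map, FormalSum.map_map, id]
    using P.act_join (a.map g)

instance faithful_forgetToModule : (forgetToModule R).Faithful where
  map_injective h :=
    Monad.Algebra.Hom.ext (ConcreteCategory.hom_ext _ _ fun x => ConcreteCategory.congr_hom h x)

theorem map_act_of_full [(forgetToModule R).Full] {P Q : Contra R} (g : P.A →ₗ[R] Q.A)
    (a : FormalSum R P.A) : g (P.act a) = Q.act (a.map g) := by
  obtain ⟨h, hh⟩ := (forgetToModule R).map_surjective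
    (ModuleCat.ofHom g : (forgetToModule R).obj P ⟶ (forgetToModule R).obj Q)
  have hg : (h.f : P.A → Q.A) = g := funext fun x => ConcreteCategory.congr_hom hh x
  exact hg ▸ hom_act h a

/-- The module underlying a free contramodule is the module of formal linear combinations. -/
noncomputable def freeEquiv (X : Type u) :
    ((formalSumMonad R).free.obj X : Contra R).A ≃ₗ[R] FormalSum R X where
  toFun a := a
  invFun a := a
  map_add' :=
    have hadd (a b : FormalSum R X) : (FormalSum.single a + FormalSum.single b).join = a + b := by
      rw [FormalSum.join_eq, FormalSum.add_bind, FormalSum.single_bind, FormalSum.single_bind, id,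
        id]
    hadd
  map_smul' :=
    have hsmul (r : R) (a : FormalSum R X) : (r • FormalSum.single a).join = r • a := by
      rw [FormalSum.join_eq, FormalSum.smul_bind, FormalSum.single_bind, id]
    hsmul

section DiscreteQuotients

variable {M : Type u} [AddCommGroup M] [Module R M] {ι : Type*} {N : ι → Type*}
  [∀ i, AddCommGroup (N i)] [∀ i, Module R (N i)]
  (hN : ∀ i, IsOpen (rightAnnihilator R (N i) : Set R)) (q : ∀ i, M →ₗ[R] N i)
  (hq : Function.Injective (LinearMap.pi q)) (α : FormalSum R M → M)
  (hα : ∀ i a, q i (α a) = FormalSum.linearCombination (hN i) (q i) a)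

/-- The contramodule with contraaction `α` on a module `M` that embeds into a product of modules
`N i` with open annihilators, when `α` induces on each of them the finite summation. -/
def ofDiscreteQuotients : Contra R where
  A := M
  a := ↾α
  unit := ConcreteCategory.hom_ext _ _ fun x => hq <| funext fun i =>
    (hα i _).trans (FormalSum.linearCombination_single (hN i) (q i) x)
  assoc := ConcreteCategory.hom_ext _ _ fun z => hq <| funext fun i =>
    have hassoc (z : FormalSum R (FormalSum R M)) : q i (α z.join) = q i (α (z.map α)) := by
      simp only [hα, FormalSum.join_eq, FormalSum.linearCombination_bind,
        FormalSum.linearCombination_map, id]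
    hassoc z

/-- The module underlying `ofDiscreteQuotients` is the given one. -/
def ofDiscreteQuotientsEquiv : (ofDiscreteQuotients hN q hq α hα).A ≃ₗ[R] M where
  toFun x := x
  invFun x := x
  map_add' :=
    have hadd (x y : M) : α (FormalSum.single x + FormalSum.single y) = x + y :=
      hq <| funext fun i => by
        simp only [LinearMap.pi_apply, hα, map_add, FormalSum.linearCombination_single]
    hadd
  map_smul' :=
    have hsmul (r : R) (x : M) : α (r • FormalSum.single x) = r • x :=
      hq <| funext fun i => by
        simp only [LinearMap.pi_apply, hα, map_smul, FormalSum.linearCombination_single]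
    hsmul

theorem isSeparated_ofDiscreteQuotients :
    isSeparated R (ofDiscreteQuotients hN q hq α hα) := by
  intro p hp
  refine (ofDiscreteQuotientsEquiv hN q hq α hα).map_eq_zero_iff.1
    ((map_eq_zero_iff _ hq).1 (funext fun i => ?_))
  obtain ⟨a, ha, rfl⟩ := hp (rightAnnihilator R (N i)) (hN i)
  exact (hα i a).trans (FormalSum.linearCombination_eq_zero (hN i) (q i) ha)

end DiscreteQuotients

theorem map_act_eq_linearCombination [(forgetToModule R).Full] (P : Contra R) {N : Type u}
    [AddCommGroup N] [Module R N] (hN : IsOpen (rightAnnihilator R N : Set R))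
    (g : P.A →ₗ[R] N) (a : FormalSum R P.A) :
    g (P.act a) = FormalSum.linearCombination hN g a := by
  let e := ofDiscreteQuotientsEquiv (ι := Unit) (fun _ => hN) (fun _ => LinearMap.id)
    (fun _ _ h => congrFun h ()) (FormalSum.linearCombination hN id) fun _ _ => rfl
  exact (map_act_of_full (e.symm.toLinearMap ∘ₗ g) a).trans
    (FormalSum.linearCombination_map hN g id a)

end Contra

end Contramodules

section TautMaps

section ClosedExtension

variable {R S : Type*} [Ring R] [Ring S] [TopologicalSpace S] [IsTopologicalRing S] (f : R →+* S)

/-- The closure of the right ideal `f(I) S`. -/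
def closedExtension (I : Submodule Rᵐᵒᵖ R) : Submodule Sᵐᵒᵖ S :=
  (Submodule.span Sᵐᵒᵖ (f '' I)).topologicalClosure

variable {f}

theorem map_mem_closedExtension {I : Submodule Rᵐᵒᵖ R} {r : R} (hr : r ∈ I) :
    f r ∈ closedExtension f I :=
  Submodule.le_topologicalClosure _ (Submodule.subset_span ⟨r, hr, rfl⟩)

theorem closedExtension_le {I : Submodule Rᵐᵒᵖ R} {K : Submodule Sᵐᵒᵖ S}
    (hK : IsOpen (K : Set S)) (h : ∀ r ∈ I, f r ∈ K) : closedExtension f I ≤ K :=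
  Submodule.topologicalClosure_minimal _ (Submodule.span_le.2 (Set.image_subset_iff.2 h))
    (K.toAddSubgroup.isClosed_of_isOpen hK)

theorem closedExtension_top : closedExtension f ⊤ = ⊤ :=
  eq_top_iff.2 fun s _ => by
    simpa using (closedExtension f ⊤).smul_mem (MulOpposite.op s)
      (map_mem_closedExtension (r := (1 : R)) Submodule.mem_top)

variable [TopologicalSpace R]

variable (f) in
/-- The ideals `I` in the definition of a strongly right taut map, viewed as right ideals; the left
stability of the closure of `f(I) S` is recorded, but not that of `I` itself. -/
structure IsTaut (I : Submodule Rᵐᵒᵖ R) : Prop where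
  isOpen : IsOpen (I : Set R)
  isOpen_closedExtension : IsOpen (closedExtension f I : Set S)
  mul_mem : ∀ (s : S), ∀ t ∈ closedExtension f I, s * t ∈ closedExtension f I

/-- For taut `I`, the closure of `f(I) S` as a left ideal, by which `S`-modules can be divided. -/
def IsTaut.ideal {I : Submodule Rᵐᵒᵖ R} (hI : IsTaut f I) : Ideal S where
  carrier := closedExtension f I
  add_mem' := (closedExtension f I).add_mem
  zero_mem' := (closedExtension f I).zero_mem
  smul_mem' := hI.mul_mem

theorem IsTaut.isOpen_rightAnnihilator {I : Submodule Rᵐᵒᵖ R} (hI : IsTaut f I) (M : Type*)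
    [AddCommGroup M] [Module S M] :
    IsOpen (rightAnnihilator S (M ⧸ (hI.ideal • ⊤ : Submodule S M)) : Set S) := by
  refine AddSubgroup.isOpen_mono (H₁ := (closedExtension f I).toAddSubgroup)
    (H₂ := (rightAnnihilator S _).toAddSubgroup) (fun s hs n => ?_) hI.isOpen_closedExtension
  obtain ⟨m, rfl⟩ := Submodule.Quotient.mk_surjective _ n
  exact (Submodule.Quotient.mk_eq_zero _).2
    (Submodule.smul_mem_smul (N := ⊤) (show s ∈ hI.ideal from hs) Submodule.mem_top)

end ClosedExtension

variable {R S : Type u} [Ring R] [UniformSpace R] [Ring S] [UniformSpace S] [IsTopologicalRing S]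
  {f : R →+* S}

theorem IsStronglyRightTaut.hasBasis (htaut : IsStronglyRightTaut f) :
    (𝓝 (0 : R)).HasBasis (IsTaut f) fun I => (I : Set R) := by
  refine htaut.to_hasBasis ?_ fun I hI =>
    htaut.mem_iff.1 (hI.isOpen.mem_nhds I.zero_mem)
  rintro I ⟨hI, J, hJ, hJI⟩
  let I' : Submodule Rᵐᵒᵖ R :=
    { carrier := I
      add_mem' := I.add_mem
      zero_mem' := I.zero_mem
      smul_mem' := fun r a ha => I.mul_mem_right a r.unop ha }
  have hJI' : (closedExtension f I' : Set S) = J := hJI.symm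
  refine ⟨I', ⟨hI, hJI' ▸ hJ, fun s t ht => ?_⟩, subset_rfl⟩
  change s * t ∈ (closedExtension f I' : Set S)
  rw [← SetLike.mem_coe, hJI'] at ht
  rw [hJI']
  exact J.mul_mem_left s t ht

namespace FormalSum

variable [IsTopologicalRing R] [IsUniformAddGroup R] [IsLinearTopology Rᵐᵒᵖ R] [T2Space R]
  [CompleteSpace R] [IsUniformAddGroup S] [IsLinearTopology Sᵐᵒᵖ S] [T2Space S] [CompleteSpace S]
  (hf : Continuous f) {X : Type v} {Y : Type w}

variable (f) in
/-- The map `R[[S × X]] → S[[X]]`, `∑ r (s, x) ↦ ∑ f(r)s x`, which expresses the formal linear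
combinations over `S` in terms of coefficients in `R`. -/
noncomputable def spread (X : Type v) : FormalSum R (S × X) →+ FormalSum S X :=
  AddMonoidHom.mk' (fun z => (z.mapCoeff f hf).bind fun p => p.1 • single p.2) fun z w => by
    rw [mapCoeff_add, add_bind]

theorem spread_apply (z : FormalSum R (S × X)) :
    spread f hf X z = (z.mapCoeff f hf).bind fun p => p.1 • single p.2 :=
  rfl

theorem spread_smul_single (r : R) (s : S) (x : X) :
    spread f hf X (r • single (s, x)) = (f r * s) • single x := by
  rw [spread_apply, mapCoeff_smul, mapCoeff_single, smul_bind, single_bind, mul_smul]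

theorem spread_mem_coeffsIn {I : Submodule Rᵐᵒᵖ R} (hI : IsOpen (closedExtension f I : Set S))
    {z : FormalSum R (S × X)} (hz : z ∈ coeffsIn I.toAddSubgroup (S × X)) :
    spread f hf X z ∈ coeffsIn (closedExtension f I).toAddSubgroup X :=
  bind_mem_coeffsIn hI (fun p => map_mem_closedExtension (hz p)) _

theorem smul_single_mem_map_spread {I : Submodule Rᵐᵒᵖ R} {t : S}
    (ht : t ∈ Submodule.span Sᵐᵒᵖ (f '' I)) (x : X) :
    t • single x ∈ (coeffsIn I.toAddSubgroup (S × X)).map (spread f hf X) := by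
  induction ht using Submodule.closure_induction with
  | zero => simpa only [zero_smul] using zero_mem _
  | add t t' _ _ ht ht' => simpa only [add_smul] using add_mem ht ht'
  | smul_mem s _ h =>
    obtain ⟨r, hr, rfl⟩ := h
    exact ⟨r • single (s.unop, x), smul_single_mem_coeffsIn hr _, spread_smul_single hf r s.unop x⟩

theorem coeffsIn_closedExtension_le_sup {I : Submodule Rᵐᵒᵖ R} {K : Submodule Sᵐᵒᵖ S}
    (hK : IsOpen (K : Set S)) :
    coeffsIn (closedExtension f I).toAddSubgroup X ≤
      (coeffsIn I.toAddSubgroup (S × X)).map (spread f hf X) ⊔ coeffsIn K.toAddSubgroup X := by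
  refine coeffsIn_le hK le_sup_right fun t ht x => ?_
  have hnhds : {t' | t - t' ∈ K} ∈ 𝓝 t :=
    (hK.preimage (continuous_const.sub continuous_id)).mem_nhds
      (by simp [K.zero_mem])
  obtain ⟨t', ht'K, ht'⟩ := mem_closure_iff_nhds.1 ht _ hnhds
  rw [← add_sub_cancel t' t, add_smul]
  exact AddSubgroup.add_mem_sup (smul_single_mem_map_spread hf ht' x)
    (smul_single_mem_coeffsIn ht'K x)

theorem spread_map (z : FormalSum R (S × X)) (g : X → Y) :
    (spread f hf X z).map g = spread f hf Y (z.map fun p => (p.1, g p.2)) := by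
  simp only [spread_apply, map_bind, mapCoeff_map, bind_map, map_smul, map_single]

theorem coeffsIn_closedExtension_le_of_hasAntitoneBasis {A : ℕ → Submodule Rᵐᵒᵖ R}
    (hA : (𝓝 (0 : R)).HasAntitoneBasis fun n => (A n : Set R))
    (hopen : ∀ n, IsOpen (closedExtension f (A n) : Set S)) :
    coeffsIn (closedExtension f (A 0)).toAddSubgroup X ≤
      (coeffsIn (A 0).toAddSubgroup (S × X)).map (spread f hf X) := by
  intro a ha
  have hstep : ∀ n, ∀ b : coeffsIn (closedExtension f (A n)).toAddSubgroup X,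
      ∃ z ∈ coeffsIn (A n).toAddSubgroup (S × X),
        b.1 - spread f hf X z ∈ coeffsIn (closedExtension f (A (n + 1))).toAddSubgroup X := by
    intro n b
    obtain ⟨_, ⟨z, hz, rfl⟩, c, hc, hzc⟩ :=
      AddSubgroup.mem_sup.1 (coeffsIn_closedExtension_le_sup hf (hopen (n + 1)) b.2)
    exact ⟨z, hz, by rwa [← hzc, add_sub_cancel_left]⟩
  choose approx happrox hremainder using hstep
  let b : ∀ n, coeffsIn (closedExtension f (A n)).toAddSubgroup X :=
    Nat.rec ⟨a, ha⟩ fun n b => ⟨_, hremainder n b⟩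
  have hb : ∀ N, a = (b N).1 + spread f hf X (∑ n ∈ Finset.range N, approx n (b n)) := by
    intro N
    induction N with
    | zero => simp [b]
    | succ N ih =>
      rw [Finset.sum_range_succ, map_add, add_comm (spread f hf X _), ← add_assoc]
      refine ih.trans (congrArg (· + _) ?_)
      exact (sub_add_cancel (b N).1 _).symm
  obtain ⟨z, hz⟩ := exists_forall_sub_sum_range_mem_coeffsIn hA fun n => happrox n (b n)
  refine ⟨z, by simpa using hz 0, (sub_eq_zero.1 <| eq_zero_of_forall_mem_coeffsIn ?_).symm⟩
  intro K hK
  obtain ⟨N, hN⟩ := hA.mem_iff.1 ((hK.preimage hf).mem_nhds (by simp [K.zero_mem]))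
  have hAK : closedExtension f (A N) ≤ K := closedExtension_le hK hN
  refine coeffsIn_mono (Submodule.toAddSubgroup_mono hAK) ?_
  rw [hb N, add_sub_assoc, ← map_sub, ← neg_sub z, map_neg]
  exact add_mem (b N).2 (neg_mem (spread_mem_coeffsIn hf (hopen N) (hz N)))

theorem coeffsIn_closedExtension_le [(𝓝 (0 : R)).IsCountablyGenerated]
    (htaut : IsStronglyRightTaut f) {I : Submodule Rᵐᵒᵖ R} (hI : IsOpen (I : Set R)) :
    coeffsIn (closedExtension f I).toAddSubgroup X ≤
      (coeffsIn I.toAddSubgroup (S × X)).map (spread f hf X) := by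
  obtain ⟨A, hAtaut, hA⟩ :=
    (htaut.hasBasis.restrict_subset (hI.mem_nhds I.zero_mem)).exists_antitone_subbasis
  have hA0 : IsOpen (closedExtension f (A 0) : Set S) := (hAtaut 0).1.isOpen_closedExtension
  refine (coeffsIn_closedExtension_le_sup hf hA0).trans (sup_le le_rfl ?_)
  refine (coeffsIn_closedExtension_le_of_hasAntitoneBasis hf hA
    fun n => (hAtaut n).1.isOpen_closedExtension).trans ?_
  exact AddSubgroup.map_mono (coeffsIn_mono (hAtaut 0).2)

theorem spread_surjective [(𝓝 (0 : R)).IsCountablyGenerated] (htaut : IsStronglyRightTaut f) :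
    Function.Surjective (spread f hf X) := fun a => by
  obtain ⟨z, -, hz⟩ := coeffsIn_closedExtension_le (X := X) hf htaut (I := ⊤) isOpen_univ
    (x := a) fun x => (closedExtension_top (f := f)).ge (Submodule.mem_top (x := a.1 x))
  exact ⟨z, hz⟩

end FormalSum

end TautMaps

section ChangeOfRings

variable {R S : Type u}
  [Ring R] [UniformSpace R] [IsUniformAddGroup R] [IsTopologicalRing R]
  [IsLinearTopology Rᵐᵒᵖ R] [T2Space R] [CompleteSpace R]
  [Ring S] [UniformSpace S] [IsTopologicalRing S]
  {f : R →+* S} (hf : Continuous f)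

section DiscreteTarget

namespace Contra

variable [(forgetToModule R).Full]

theorem map_act_eq_linearCombination_mapCoeff (P : Contra R) {N : Type u} [AddCommGroup N]
    [Module S N] (hN : IsOpen (rightAnnihilator S N : Set S)) (g : P.A →ₛₗ[f] N)
    (a : FormalSum R P.A) :
    g (P.act a) = FormalSum.linearCombination hN g (a.mapCoeff f hf) := by
  let _ : Module R N := Module.compHom N f
  have hNR : IsOpen (rightAnnihilator R N : Set R) := hN.preimage hf
  exact map_act_eq_linearCombination P hNR
    ({ g with map_smul' := g.map_smulₛₗ } : P.A →ₗ[R] N) a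

theorem linearCombination_mapCoeff (P : Contra R) {M : Type u} [AddCommGroup M] [Module S M]
    (e : P.A ≃+ M) (he : ∀ (r : R) x, e (r • x) = f r • e x) {N : Type u} [AddCommGroup N]
    [Module S N] (hN : IsOpen (rightAnnihilator S N : Set S)) (q : M →ₗ[S] N)
    (a : FormalSum R P.A) :
    FormalSum.linearCombination hN (fun x => q (e x)) (a.mapCoeff f hf) = q (e (P.act a)) :=
  (map_act_eq_linearCombination_mapCoeff hf P hN
    (q.comp ({ e.toAddMonoidHom with map_smul' := he } : P.A →ₛₗ[f] M)) a).symm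

end Contra

end DiscreteTarget

variable [IsUniformAddGroup S] [IsLinearTopology Sᵐᵒᵖ S] [T2Space S] [CompleteSpace S]

namespace Contra

/-- Restriction of scalars does not change the additive group.  The two additions are given by
different contraactions, so that this is not definitional. -/
def restrictScalarsEquiv (P : Contra S) : ((restrictScalars f hf).obj P).A ≃+ P.A where
  toFun x := x
  invFun x := x
  map_add' := restrictScalars_add f hf P

theorem restrictScalarsEquiv_smul (P : Contra S) (r : R)
    (x : ((restrictScalars f hf).obj P).A) :
    restrictScalarsEquiv hf P (r • x) = f r • restrictScalarsEquiv hf P x :=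
  restrictScalars_smul f hf P r x

theorem act_spread (P : Contra S) (z : FormalSum R (S × P.A)) :
    P.act (FormalSum.spread f hf P.A z) =
      P.act ((z.map fun p => p.1 • p.2).mapCoeff f hf) := by
  rw [FormalSum.spread_apply, act_bind, FormalSum.mapCoeff_map]
  rfl

section Full

variable [(forgetToModule R).Full]

theorem map_act_mapCoeff (P : Contra S) (Q : Contra R) (g : P.A →+ Q.A)
    (hg : ∀ (r : R) x, g (f r • x) = r • g x) (a : FormalSum R P.A) :
    g (P.act (a.mapCoeff f hf)) = Q.act (a.map g) :=
  map_act_of_full (P := (restrictScalars f hf).obj P)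
    { g.comp (restrictScalarsEquiv hf P).toAddMonoidHom with
      map_smul' := fun r x => (congrArg g (restrictScalarsEquiv_smul hf P r x)).trans (hg r _) } a

theorem map_act_spread (P Q : Contra S) (g : P.A →ₗ[S] Q.A) (z : FormalSum R (S × P.A)) :
    g (P.act (FormalSum.spread f hf P.A z)) =
      Q.act ((FormalSum.spread f hf P.A z).map g) := by
  let e := restrictScalarsEquiv hf Q
  have he (r : R) (x : P.A) : e.symm (g (f r • x)) = r • e.symm (g x) := by
    rw [AddEquiv.symm_apply_eq, restrictScalarsEquiv_smul, e.apply_symm_apply, map_smul]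
  calc g (P.act (FormalSum.spread f hf P.A z))
      = Q.act (((z.map fun p => p.1 • p.2).map g).mapCoeff f hf) :=
        (congrArg g (act_spread hf P z)).trans
          (map_act_mapCoeff hf P _ (e.symm.toAddMonoidHom.comp g.toAddMonoidHom) he _)
    _ = Q.act ((FormalSum.spread f hf P.A z).map g) := by
        rw [FormalSum.spread_map, act_spread, FormalSum.map_map, FormalSum.map_map]
        simp only [map_smul]

include hf in
theorem full_forgetToModule [(𝓝 (0 : R)).IsCountablyGenerated] (htaut : IsStronglyRightTaut f) :
    (forgetToModule S).Full where
  map_surjective {P Q} g := by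
    refine ⟨⟨↾g.hom, ConcreteCategory.hom_ext _ _ fun a => ?_⟩, rfl⟩
    obtain ⟨z, rfl⟩ := FormalSum.spread_surjective hf htaut a
    exact (map_act_spread hf P Q g.hom z).symm

section Extension

variable (P : Contra R) {M : Type u} [AddCommGroup M] [Module S M] (e : P.A ≃+ M)
  (he : ∀ (r : R) x, e (r • x) = f r • e x)

include he

theorem linearCombination_spread {N : Type u} [AddCommGroup N] [Module S N]
    (hN : IsOpen (rightAnnihilator S N : Set S)) (q : M →ₗ[S] N) (z : FormalSum R (S × M)) :
    FormalSum.linearCombination hN q (FormalSum.spread f hf M z) =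
      q (e (P.act (z.map fun p => e.symm (p.1 • p.2)))) := by
  rw [← linearCombination_mapCoeff hf P e he hN q, FormalSum.spread_apply,
    FormalSum.linearCombination_bind, FormalSum.mapCoeff_map, FormalSum.linearCombination_map]
  simp only [e.apply_symm_apply, map_smul, FormalSum.linearCombination_single]

variable [(𝓝 (0 : R)).IsCountablyGenerated] (htaut : IsStronglyRightTaut f)

include hf htaut

theorem symm_smul_mem_contraSMul {I : Submodule Rᵐᵒᵖ R} (hI : IsOpen (I : Set R)) {s : S}
    (hs : s ∈ closedExtension f I) (m : M) :
    e.symm (s • m) ∈ contraSMul I.toAddSubgroup P := by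
  -- Over `R`, multiplication of `m` by elements of `S` is a map from the free `S`-contramodule on
  -- one generator to `P`, so it commutes with the contraactions.
  let F : Contra S := (formalSumMonad S).free.obj PUnit
  let φ : F.A →+ P.A :=
    AddMonoidHom.mk' (fun a => e.symm ((freeEquiv PUnit a).1 PUnit.unit • m)) fun a b => by
      rw [map_add, Submodule.coe_add, Pi.add_apply, add_smul, map_add]
  have hφ (r : R) (a : F.A) : φ (f r • a) = r • φ a := by
    change e.symm ((freeEquiv PUnit (f r • a)).1 PUnit.unit • m) = r • e.symm (_ • m)
    rw [AddEquiv.symm_apply_eq, he, e.apply_symm_apply, map_smul, Submodule.coe_smul,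
      Pi.smul_apply, smul_assoc]
  obtain ⟨z, hz, hzs⟩ := FormalSum.coeffsIn_closedExtension_le hf htaut hI
    (FormalSum.smul_single_mem_coeffsIn hs PUnit.unit)
  let w : FormalSum R (FormalSum S PUnit) := z.map fun p => p.1 • FormalSum.single p.2
  have hw : (w.mapCoeff f hf).join = FormalSum.spread f hf PUnit z := by
    rw [FormalSum.mapCoeff_map, FormalSum.join_eq, FormalSum.bind_map]
    rfl
  refine ⟨FormalSum.map φ w, FormalSum.map_mem_coeffsIn hI (FormalSum.map_mem_coeffsIn hI hz _) _,
    ?_⟩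
  calc P.act (FormalSum.map φ w)
      = φ (F.act (FormalSum.mapCoeff f hf w)) := (map_act_mapCoeff hf F P φ hφ w).symm
    _ = e.symm ((w.mapCoeff f hf).join.1 PUnit.unit • m) := rfl
    _ = e.symm (s • m) := by rw [hw, hzs, FormalSum.smul_single_apply_self]

theorem symm_mem_contraSMul {I : Submodule Rᵐᵒᵖ R} (hI : IsTaut f I) {x : M}
    (hx : x ∈ (hI.ideal • ⊤ : Submodule S M)) : e.symm x ∈ contraSMul I.toAddSubgroup P := by
  induction hx using Submodule.smul_induction_on' with
  | smul s hs m _ => exact symm_smul_mem_contraSMul hf P e he htaut hI.isOpen hs m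
  | add x _ y _ hx hy => exact (map_add e.symm x y).symm ▸ add_mem hx hy

theorem injective_pi_mkQ (hP : isSeparated R P) :
    Function.Injective
      (LinearMap.pi fun I : {I // IsTaut f I} => (I.2.ideal • ⊤ : Submodule S M).mkQ) := by
  refine (injective_iff_map_eq_zero _).2 fun x hx => ?_
  refine e.symm.map_eq_zero_iff.1 (hP _ fun K hK => ?_)
  obtain ⟨I, hI, hIK⟩ := htaut.hasBasis.mem_iff.1 (hK.mem_nhds K.zero_mem)
  obtain ⟨a, ha, hax⟩ := symm_mem_contraSMul hf P e he htaut hI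
    ((Submodule.Quotient.mk_eq_zero _).1 (congrFun hx ⟨I, hI⟩))
  exact ⟨a, FormalSum.coeffsIn_mono hIK ha, hax⟩

theorem exists_contra_of_separated (hP : isSeparated R P) :
    ∃ Q : Contra S, isSeparated S Q ∧ ∃ i : Q.A ≃ₗ[S] M, ∀ a : FormalSum R Q.A,
      e (P.act (a.map fun x => e.symm (i x))) = i (Q.act (a.mapCoeff f hf)) := by
  let q (I : {I // IsTaut f I}) := (I.2.ideal • ⊤ : Submodule S M).mkQ
  have hq : Function.Injective (LinearMap.pi q) := injective_pi_mkQ hf P e he htaut hP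
  have hN (I : {I // IsTaut f I}) := I.2.isOpen_rightAnnihilator M
  choose lift hlift using FormalSum.spread_surjective (X := M) hf htaut
  let α (a : FormalSum S M) : M := e (P.act ((lift a).map fun p => e.symm (p.1 • p.2)))
  have hα (I) (a : FormalSum S M) :
      q I (α a) = FormalSum.linearCombination (hN I) (q I) a := by
    rw [← linearCombination_spread hf P e he (hN I), hlift]
  refine ⟨ofDiscreteQuotients hN q hq α hα, isSeparated_ofDiscreteQuotients hN q hq α hα,
    ofDiscreteQuotientsEquiv hN q hq α hα, fun a => hq (funext fun I => ?_)⟩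
  refine .trans ?_ (hα I _).symm
  refine (linearCombination_mapCoeff hf P e he (hN I) (q I) _).symm.trans ?_
  rw [FormalSum.mapCoeff_map, FormalSum.linearCombination_map]
  simp only [e.apply_symm_apply]
  rfl

end Extension

end Full

end Contra

namespace Separ

variable [(Contra.forgetToModule R).Full] [(𝓝 (0 : R)).IsCountablyGenerated]
  (htaut : IsStronglyRightTaut f)

include htaut

theorem exists_forgetToModule_iso_restrictScalars_iso (M : ModuleCat.{u} S) (P : Separ R)
    (φ : (ModuleCat.restrictScalars.{u} f).obj M ≅ (forgetToModule R).obj P) :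
    ∃ (Q : Separ S) (i : (forgetToModule S).obj Q ≅ M) (j : (restrictScalars f hf).obj Q ≅ P),
      ∀ x, φ.hom.hom (i.hom.hom x) = j.hom.hom.f x := by
  let e : M ≃+ P.obj.A := φ.toLinearEquiv.toAddEquiv
  have he (r : R) (x : P.obj.A) : e.symm (r • x) = f r • e.symm x :=
    φ.toLinearEquiv.symm.map_smul r x
  obtain ⟨Q, hQ, i, hi⟩ := Contra.exists_contra_of_separated hf P.obj e.symm he htaut P.property
  let j : (Contra.restrictScalars f hf).obj Q ≅ P.obj :=
    Monad.Algebra.isoMk (i.toEquiv.trans e.toEquiv).toIso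
      (ConcreteCategory.hom_ext _ _ fun a => e.symm_apply_eq.1 (hi a))
  exact ⟨⟨Q, hQ⟩, i.toModuleIso, (Contra.isSeparated R).isoMk j, fun _ => rfl⟩

theorem isPseudopullback_squareIso : IsPseudopullback (squareIso f hf) := by
  have := Contra.full_forgetToModule hf htaut
  refine { faithful := ⟨?_⟩, full := ⟨?_⟩, essSurj := ⟨?_⟩ }
  · intro P Q g h hgh
    exact (forgetToModule S).map_injective (congrArg Limits.CategoricalPullback.Hom.fst hgh)
  · intro P Q h
    obtain ⟨k, hk⟩ := (forgetToModule S).map_surjective h.fst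
    refine ⟨k, Limits.CategoricalPullback.hom_ext hk ?_⟩
    refine ObjectProperty.hom_ext _
      (Monad.Algebra.Hom.ext (ConcreteCategory.hom_ext _ _ fun x => ?_))
    exact (ConcreteCategory.congr_hom hk x).trans (ConcreteCategory.congr_hom h.w x)
  · rintro ⟨M, P, φ⟩
    obtain ⟨Q, i, j, hij⟩ := exists_forgetToModule_iso_restrictScalars_iso hf htaut M P φ
    exact ⟨Q, ⟨Limits.CategoricalPullback.mkIso i j (ModuleCat.hom_ext (LinearMap.ext hij))⟩⟩

end Separ

end ChangeOfRings

theorem mainTheorem7 {R S : Type u}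
    [Ring R] [UniformSpace R] [IsUniformAddGroup R] [IsTopologicalRing R]
    [IsLinearTopology R R] [IsLinearTopology Rᵐᵒᵖ R] [T2Space R] [CompleteSpace R]
    [Ring S] [UniformSpace S] [IsUniformAddGroup S] [IsTopologicalRing S]
    [IsLinearTopology S S] [IsLinearTopology Sᵐᵒᵖ S] [T2Space S] [CompleteSpace S]
    (hR : (𝓝 (0 : R)).IsCountablyGenerated) (hS : (𝓝 (0 : S)).IsCountablyGenerated)
    (f : R →+* S) (hf : Continuous f) (htaut : IsStronglyRightTaut f)
    (hfull : (Contra.forgetToModule R).Full ∧ (Contra.forgetToModule R).Faithful) :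
    IsPseudopullback (Separ.squareIso f hf) ∧
      ((Separ.forgetToModule S).Full ∧ (Separ.forgetToModule S).Faithful) ∧
      ((Separ.forgetToModule R).Full ∧ (Separ.forgetToModule R).Faithful) ∧
      ((Contra.forgetToModule S).Full ∧ (Contra.forgetToModule S).Faithful) := by
  have := hfull.1
  have := Contra.full_forgetToModule hf htaut
  exact ⟨Separ.isPseudopullback_squareIso hf htaut, ⟨inferInstance, inferInstance⟩,
    ⟨inferInstance, inferInstance⟩, inferInstance, inferInstance⟩
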